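/- **Theorem (Free cocompletion of $\mathcal M$-categories).** *Definitions.* A *stable system of monics* in a category $\mathcal C$ is a class $\mathcal M_{\mathcal C}$ of monomorphisms of $\mathcal C$ which contains all isomorphisms, is closed under composition, and is such that the pullback of any $m\in\mathcal M_{\mathcal C}$ along an arbitrary map of $\mathcal C$ exists and lies in $\mathcal M_{\mathcal C}$. An *$\mathcal M$-category* is a category $\mathcal C$ with a stable system of monics $\mathcal M_{\mathcal C}$. An *$\mathcal M$-functor* $F\colon\mathcal C\to\mathcal D$ between $\mathcal M$-categories is a functor such that $m\in\mathcal M_{\mathcal C}$ implies $Fm\in\mathcal M_{\mathcal D}$ and which preserves pullbacks of maps in $\mathcal M_{\mathcal C}$. A natural transformation between $\mathcal M$-functors is *$\mathcal M$-cartesian* if its naturality square at every $m\in\mathcal M_{\mathcal C}$ is a pullback. The category $\mathsf{Par}(\mathcal C)$ has the objects of $\mathcal C$; its morphisms $X\to Y$ are spans $(m,f)=(X\xleftarrow{m}Z\xrightarrow{f}Y)$ with $m\in\mathcal M_{\mathcal C}$, where $(m,f)$ and $(n,g)$ are identified if there is an isomorphism $\varphi$ with $m\varphi=n$ and $f\varphi=g$;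 composition is by pullback and identities are $(1,1)$. The inclusion $\mathcal C\hookrightarrow\mathsf{Par}(\mathcal C)$ sends $f$ to $(1,f)$. An $\mathcal M$-category $\mathcal C$ is *cocomplete* if $\mathcal C$ has all small colimits and the inclusion $\mathcal C\hookrightarrow\mathsf{Par}(\mathcal C)$ preserves them. An $\mathcal M$-functor is *cocontinuous* if its underlying functor preserves small colimits. Write $\mathcal M\mathbf{Cat}(\mathcal C,\mathcal D)$ for the category of $\mathcal M$-functors $\mathcal C\to\mathcal D$ and $\mathcal M$-cartesian natural transformations and, for $\mathcal C,\mathcal D$ cocomplete, $\mathcal M\mathbf{Cocomp}(\mathcal C,\mathcal D)$ for its full subcategory on the cocontinuous $\mathcal M$-functors. For a small $\mathcal M$-category $\mathcal C$ with Yoneda embedding $\mathbf y\colon\mathcal C\to\mathsf{PSh}(\mathcal C)$, let $\mathsf{PSh}_{\mathcal M}(\mathcal C)$ be the $\mathcal M$-category of presheaves of sets on $\mathcal C$ whose stable system of monics consists of the maps $\mu\colon P\Rightarrow Q$ such that for every object $D$ of $\mathcal C$ and every $\gamma\colon\mathbf yD\Rightarrow Q$ there are $m\colon C\to D$ in $\mathcal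 M_{\mathcal C}$ and a map $\mathbf yC\Rightarrow P$ making $$\begin{array}{ccc}\mathbf yC&\longrightarrow&P\\ {\scriptstyle \mathbf ym}\downarrow&&\downarrow{\scriptstyle\mu}\\ \mathbf yD&\xrightarrow{\ \gamma\ }&Q\end{array}$$ a pullback square. The functor $\mathbf y\colon\mathcal C\to\mathsf{PSh}_{\mathcal M}(\mathcal C)$ is an $\mathcal M$-functor. *Statement.* Let $\mathcal C$ be a small $\mathcal M$-category and $\mathcal D$ a cocomplete $\mathcal M$-category. Then $\mathsf{PSh}_{\mathcal M}(\mathcal C)$ is a cocomplete $\mathcal M$-category, and precomposition with the Yoneda embedding $$(-)\circ\mathbf y\colon \mathcal M\mathbf{Cocomp}(\mathsf{PSh}_{\mathcal M}(\mathcal C),\mathcal D)\to\mathcal M\mathbf{Cat}(\mathcal C,\mathcal D)$$ is an equivalence of categories. -/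

import Mathlib

open CategoryTheory CategoryTheory.Limits

universe w v v₁ v₂ v₃ u u₁ u₂ u₃

namespace MCat

/-! ### `M`-categories -/

/-- A stable system of monics in a category: a class of monomorphisms containing all isomorphisms,
closed under composition, and such that the pullback of a member along an arbitrary map exists and
is again a member. A category together with such a class `M` is an `M`-category. -/
class StableMonics {C : Type u} [Category.{v} C] (M : MorphismProperty C) : Prop where
  mono : ∀ {X Y : C} (m : X ⟶ Y), M m → Mono m
  of_isIso : ∀ {X Y : C} (e : X ⟶ Y), IsIso e → M e
  comp : ∀ {X Y Z : C} (m : X ⟶ Y) (n : Y ⟶ Z), M m → M n → M (m ≫ n)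
  hasPullback : ∀ {X Y Z : C} (m : X ⟶ Z) (f : Y ⟶ Z), M m → HasPullback m f
  of_isPullback : ∀ {P X Y Z : C} {p : P ⟶ X} {n : P ⟶ Y} {m : X ⟶ Z} {f : Y ⟶ Z},
    IsPullback p n m f → M m → M n

section
variable {C : Type u} [Category.{v} C] (M : MorphismProperty C) [StableMonics M]

instance : M.IsMultiplicative where
  id_mem X := StableMonics.of_isIso (𝟙 X) inferInstance
  comp_mem m n hm hn := StableMonics.comp m n hm hn

instance : M.IsStableUnderBaseChange where
  of_isPullback sq h := StableMonics.of_isPullback sq h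

instance : M.HasPullbacks where
  hasPullback f h := StableMonics.hasPullback _ f h

end

/-! ### The category of partial maps -/

section Par
variable {C : Type u} [Category.{v} C] (M : MorphismProperty C)

/-- A span `X ⟵ dom ⟶ Y` whose left leg is in `M`. -/
structure PartialSpan (X Y : C) where
  /-- the apex -/
  dom : C
  /-- the left leg -/
  m : dom ⟶ X
  /-- the left leg is in `M` -/
  mem : M m
  /-- the right leg -/
  f : dom ⟶ Y

/-- Two spans are identified if there is an isomorphism of apices compatible with both legs. -/
def PartialSpan.setoid (X Y : C) : Setoid (PartialSpan M X Y) where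
  r s t := ∃ φ : t.dom ≅ s.dom, φ.hom ≫ s.m = t.m ∧ φ.hom ≫ s.f = t.f
  iseqv :=
    { refl := fun s => ⟨Iso.refl _, by simp, by simp⟩
      symm := by
        rintro s t ⟨φ, h₁, h₂⟩
        exact ⟨φ.symm, by simp [← h₁], by simp [← h₂]⟩
      trans := by
        rintro s t r ⟨φ, h₁, h₂⟩ ⟨ψ, h₃, h₄⟩
        exact ⟨ψ ≪≫ φ, by simp [h₁, h₃], by simp [h₂, h₄]⟩ }

/-- Partial maps from `X` to `Y`: equivalence classes of spans with left leg in `M`. -/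
def PartialMap (X Y : C) : Type max u v := Quotient (PartialSpan.setoid M X Y)

variable {M}

/-- The partial map `(m, f)`. -/
def PartialMap.mk {X Y Z : C} (m : Z ⟶ X) (hm : M m) (f : Z ⟶ Y) : PartialMap M X Y :=
  Quotient.mk (PartialSpan.setoid M X Y) ⟨Z, m, hm, f⟩

lemma PartialMap.mk_eq_mk_iff {X Y Z Z' : C} (m : Z ⟶ X) (hm : M m) (f : Z ⟶ Y)
    (n : Z' ⟶ X) (hn : M n) (g : Z' ⟶ Y) :
    PartialMap.mk m hm f = PartialMap.mk n hn g ↔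
      ∃ φ : Z' ≅ Z, φ.hom ≫ m = n ∧ φ.hom ≫ f = g :=
  Quotient.eq (r := PartialSpan.setoid M X Y)

lemma PartialMap.ind {X Y : C} {p : PartialMap M X Y → Prop}
    (h : ∀ (Z : C) (m : Z ⟶ X) (hm : M m) (f : Z ⟶ Y), p (PartialMap.mk m hm f))
    (a : PartialMap M X Y) : p a :=
  Quotient.ind (fun s => h s.dom s.m s.mem s.f) a

variable [StableMonics M]

/-- The composite of two spans, computed by pullback. -/
noncomputable def PartialSpan.comp {X Y Z : C} (s : PartialSpan M X Y) (t : PartialSpan M Y Z) :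
    PartialMap M X Z :=
  have : HasPullback t.m s.f := StableMonics.hasPullback t.m s.f t.mem
  PartialMap.mk (pullback.snd t.m s.f ≫ s.m)
    (M.comp_mem _ _ (M.of_isPullback (IsPullback.of_hasPullback t.m s.f) t.mem) s.mem)
    (pullback.fst t.m s.f ≫ t.f)

/-- Any pullback square may be used to compute a composite. -/
lemma PartialSpan.comp_eq {X Y Z : C} (s : PartialSpan M X Y) (t : PartialSpan M Y Z) {P : C}
    {p : P ⟶ t.dom} {q : P ⟶ s.dom} (sq : IsPullback p q t.m s.f) :
    s.comp t = PartialMap.mk (q ≫ s.m)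
      (M.comp_mem _ _ (M.of_isPullback sq t.mem) s.mem) (p ≫ t.f) := by
  have : HasPullback t.m s.f := StableMonics.hasPullback t.m s.f t.mem
  refine (PartialMap.mk_eq_mk_iff _ _ _ _ _ _).2 ⟨sq.isoPullback, ?_, ?_⟩
  · rw [← Category.assoc, sq.isoPullback_hom_snd]
  · rw [← Category.assoc, sq.isoPullback_hom_fst]

/-- Composition of partial maps. -/
noncomputable def PartialMap.comp {X Y Z : C} (a : PartialMap M X Y) (b : PartialMap M Y Z) :
    PartialMap M X Z :=
  Quotient.lift₂ (s₁ := PartialSpan.setoid M X Y) (s₂ := PartialSpan.setoid M Y Z)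
    PartialSpan.comp (by
      rintro s t s' t' ⟨φ, h₁, h₂⟩ ⟨ψ, h₃, h₄⟩
      have : HasPullback t'.m s'.f := StableMonics.hasPullback _ _ t'.mem
      have sq := IsPullback.of_hasPullback t'.m s'.f
      have sq' : IsPullback (pullback.fst t'.m s'.f ≫ ψ.hom) (pullback.snd t'.m s'.f ≫ φ.hom)
          t.m s.f :=
        sq.of_iso (Iso.refl _) ψ φ (Iso.refl _) (by simp) (by simp) (by simp [h₃]) (by simp [h₂])
      rw [PartialSpan.comp_eq s t sq', PartialSpan.comp_eq s' t' sq]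
      exact (PartialMap.mk_eq_mk_iff _ _ _ _ _ _).2
        ⟨Iso.refl _, by simp [h₁], by simp [h₄]⟩) a b

lemma PartialMap.mk_comp_mk {X Y Z A B P : C} (m : A ⟶ X) (hm : M m) (f : A ⟶ Y)
    (n : B ⟶ Y) (hn : M n) (g : B ⟶ Z) {p : P ⟶ B} {q : P ⟶ A} (sq : IsPullback p q n f) :
    (PartialMap.mk m hm f).comp (PartialMap.mk n hn g) =
      PartialMap.mk (q ≫ m) (M.comp_mem _ _ (M.of_isPullback sq hn) hm) (p ≫ g) :=
  PartialSpan.comp_eq ⟨A, m, hm, f⟩ ⟨B, n, hn, g⟩ sq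

variable (M)

/-- The objects of the category of partial maps: the same as those of `C`. -/
structure Par {C : Type u} [Category.{v} C] (M : MorphismProperty C) where
  /-- the underlying object -/
  obj : C

/-- The category `Par(C)` of partial maps. -/
noncomputable instance : Category.{max u v} (Par M) where
  Hom X Y := PartialMap M X.obj Y.obj
  id X := PartialMap.mk (𝟙 X.obj) (M.id_mem _) (𝟙 X.obj)
  comp a b := a.comp b
  id_comp {X Y} a := by
    induction a using PartialMap.ind with
    | _ Z m hm f =>
      have sq : IsPullback (𝟙 Z) m m (𝟙 X.obj) := IsPullback.of_id_fst
      rw [PartialMap.mk_comp_mk _ _ _ _ _ _ sq]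
      exact (PartialMap.mk_eq_mk_iff _ _ _ _ _ _).2 ⟨Iso.refl _, by simp, by simp⟩
  comp_id {X Y} a := by
    induction a using PartialMap.ind with
    | _ Z m hm f =>
      have sq : IsPullback f (𝟙 Z) (𝟙 Y.obj) f := IsPullback.of_id_snd
      rw [PartialMap.mk_comp_mk _ _ _ _ _ _ sq]
      exact (PartialMap.mk_eq_mk_iff _ _ _ _ _ _).2 ⟨Iso.refl _, by simp, by simp⟩
  assoc {W X Y Z} a b c := by
    induction a using PartialMap.ind with
    | _ A m hm f =>
    induction b using PartialMap.ind with
    | _ B n hn g =>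
    induction c using PartialMap.ind with
    | _ D k hk h =>
      have : HasPullback n f := StableMonics.hasPullback _ _ hn
      have : HasPullback k g := StableMonics.hasPullback _ _ hk
      have sq₁ := IsPullback.of_hasPullback n f
      have sq₂ := IsPullback.of_hasPullback k g
      have h₂ : M (pullback.snd k g) := M.of_isPullback sq₂ hk
      have : HasPullback (pullback.snd k g) (pullback.fst n f) :=
        StableMonics.hasPullback _ _ h₂
      have sq₃ := IsPullback.of_hasPullback (pullback.snd k g) (pullback.fst n f)
      rw [PartialMap.mk_comp_mk _ _ _ _ _ _ sq₁, PartialMap.mk_comp_mk _ _ _ _ _ _ sq₂,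
        PartialMap.mk_comp_mk _ _ _ _ _ _ (sq₃.paste_horiz sq₂),
        PartialMap.mk_comp_mk _ _ _ _ _ _ (sq₃.paste_vert sq₁)]
      exact (PartialMap.mk_eq_mk_iff _ _ _ _ _ _).2 ⟨Iso.refl _, by simp, by simp⟩

/-- The inclusion of `C` into `Par(C)`, sending `f` to the partial map `(1, f)`. -/
noncomputable def Par.incl : C ⥤ Par M where
  obj X := ⟨X⟩
  map {X Y} f := PartialMap.mk (𝟙 X) (M.id_mem _) f
  map_id _ := rfl
  map_comp {X Y Z} f g := by
    have sq : IsPullback f (𝟙 X) (𝟙 Y) f := IsPullback.of_id_snd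
    refine Eq.trans ?_ (PartialMap.mk_comp_mk _ _ _ _ _ _ sq).symm
    exact (PartialMap.mk_eq_mk_iff _ _ _ _ _ _).2 ⟨Iso.refl _, by simp, by simp⟩

/-- An `M`-category is cocomplete (with respect to diagrams in the universe `w`) if its underlying
category is cocomplete and the inclusion into its category of partial maps preserves colimits. -/
structure IsCocomplete : Prop where
  hasColimits : HasColimitsOfSize.{w, w} C
  preservesColimits : PreservesColimitsOfSize.{w, w} (Par.incl M)

end Par

/-! ### `M`-functors and `M`-cartesian natural transformations -/

section MFunctor

/-- An `M`-functor: a functor which sends members of `M` to members of `N` and preserves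
pullbacks of members of `M`. -/
structure MFunctor {C : Type u₁} [Category.{v₁} C] (M : MorphismProperty C)
    {D : Type u₂} [Category.{v₂} D] (N : MorphismProperty D) extends C ⥤ D where
  map_mem : ∀ {X Y : C} (m : X ⟶ Y), M m → N (toFunctor.map m)
  map_isPullback : ∀ {P X Y Z : C} {p : P ⟶ X} {n : P ⟶ Y} {m : X ⟶ Z} {f : Y ⟶ Z},
    M m → IsPullback p n m f →
      IsPullback (toFunctor.map p) (toFunctor.map n) (toFunctor.map m) (toFunctor.map f)

/-- A natural transformation is `M`-cartesian if its naturality squares at the members of `M` are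
pullbacks. -/
def IsMCartesian {C : Type u₁} [Category.{v₁} C] (M : MorphismProperty C)
    {D : Type u₂} [Category.{v₂} D] {F G : C ⥤ D} (α : F ⟶ G) : Prop :=
  ∀ ⦃X Y : C⦄ (m : X ⟶ Y), M m → IsPullback (α.app X) (F.map m) (G.map m) (α.app Y)

variable {C : Type u₁} [Category.{v₁} C] {M : MorphismProperty C}
  {D : Type u₂} [Category.{v₂} D] {N : MorphismProperty D}
  {E : Type u₃} [Category.{v₃} E] {K : MorphismProperty E}

/-- An `M`-cartesian natural transformation between `M`-functors. -/
@[ext]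
structure MFunctor.Hom (F G : MFunctor M N) where
  /-- the underlying natural transformation -/
  nat : F.toFunctor ⟶ G.toFunctor
  /-- it is `M`-cartesian -/
  cartesian : IsMCartesian M nat

/-- The category of `M`-functors and `M`-cartesian natural transformations. -/
instance : Category (MFunctor M N) where
  Hom F G := MFunctor.Hom F G
  id F := ⟨𝟙 F.toFunctor, fun _ _ _ _ => IsPullback.of_horiz_isIso ⟨by simp⟩⟩
  comp α β := ⟨α.nat ≫ β.nat, fun _ _ m hm => by
    simpa using (α.cartesian m hm).paste_horiz (β.cartesian m hm)⟩
  id_comp _ := MFunctor.Hom.ext (Category.id_comp _)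
  comp_id _ := MFunctor.Hom.ext (Category.comp_id _)
  assoc _ _ _ := MFunctor.Hom.ext (Category.assoc _ _ _)

/-- Composition of `M`-functors. -/
def MFunctor.comp (F : MFunctor M N) (G : MFunctor N K) : MFunctor M K where
  toFunctor := F.toFunctor ⋙ G.toFunctor
  map_mem m hm := G.map_mem _ (F.map_mem m hm)
  map_isPullback hm sq := G.map_isPullback (F.map_mem _ hm) (F.map_isPullback hm sq)

/-- Precomposition with an `M`-functor, as a functor. -/
def MFunctor.precomp (F : MFunctor M N) (K : MorphismProperty E) :
    MFunctor N K ⥤ MFunctor M K where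
  obj G := F.comp G
  map α := ⟨Functor.whiskerLeft F.toFunctor α.nat, fun _ _ m hm =>
    α.cartesian (F.toFunctor.map m) (F.map_mem m hm)⟩
  map_id _ := rfl
  map_comp _ _ := rfl

variable (M N)

/-- The `M`-functors whose underlying functor is cocontinuous, i.e. preserves `w`-small colimits. -/
def isCocontinuous : ObjectProperty (MFunctor M N) :=
  fun F => PreservesColimitsOfSize.{w, w} F.toFunctor

/-- The category of cocontinuous `M`-functors and `M`-cartesian natural transformations. -/
abbrev MCocomp := (isCocontinuous.{w} M N).FullSubcategory

end MFunctor

/-! ### The `M`-category of presheaves -/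

section Presheaf
variable {C : Type w} [SmallCategory.{w} C] (M : MorphismProperty C)

/-- The class of maps `μ : P ⟶ Q` of presheaves such that every `γ : y D ⟶ Q` fits in a pullback
square over `μ` whose opposite side is `y m : y C ⟶ y D` for some `m ∈ M`. -/
def presheafMonics : MorphismProperty (Cᵒᵖ ⥤ Type w) := fun P _ μ =>
  ∀ ⦃B : C⦄ (γ : yoneda.obj B ⟶ _), ∃ (A : C) (m : A ⟶ B) (p : yoneda.obj A ⟶ P),
    M m ∧ IsPullback p (yoneda.map m) μ γ

variable [StableMonics M]

lemma presheafMonics_eq : presheafMonics M = M.presheaf := by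
  ext P Q μ
  constructor
  · intro h
    refine MorphismProperty.relative.of_exists fun B γ => ?_
    obtain ⟨A, m, p, hm, sq⟩ := h γ
    exact ⟨A, p, m, sq, hm⟩
  · intro h B γ
    exact ⟨_, _, _, h.property_snd γ, h.rep.isPullback γ⟩

/-- Presheaves form an `M`-category. -/
instance : StableMonics (presheafMonics M) where
  mono μ h := by
    rw [presheafMonics_eq] at h
    exact MorphismProperty.presheaf_monomorphisms_le_monomorphisms _
      (MorphismProperty.relative_monotone (fun _ _ m hm => StableMonics.mono m hm) _ h)
  of_isIso e _ B γ := ⟨B, 𝟙 B, γ ≫ inv e, M.id_mem _, IsPullback.of_vert_isIso ⟨by simp⟩⟩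
  comp μ ν hμ hν := by
    rw [presheafMonics_eq] at *
    exact MorphismProperty.comp_mem _ _ _ hμ hν
  hasPullback _ _ _ := inferInstance
  of_isPullback sq h := by
    rw [presheafMonics_eq] at *
    exact (MorphismProperty.relative_isStableUnderBaseChange M).of_isPullback sq h

/-- The Yoneda embedding as an `M`-functor. -/
def yonedaM : MFunctor M (presheafMonics M) where
  toFunctor := yoneda
  map_mem {X Y} m hm B γ := by
    obtain ⟨g, rfl⟩ := yoneda.map_surjective γ
    have : HasPullback m g := StableMonics.hasPullback m g hm
    have sq := IsPullback.of_hasPullback m g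
    exact ⟨_, pullback.snd m g, yoneda.map (pullback.fst m g), M.of_isPullback sq hm, sq.map yoneda⟩
  map_isPullback _ sq := sq.map yoneda

/-- Precomposition with the Yoneda embedding, from cocontinuous `M`-functors on presheaves to
`M`-functors on `C`. -/
def precompYoneda {D : Type u} [Category.{v} D] (N : MorphismProperty D) :
    MCocomp.{w} (presheafMonics M) N ⥤ MFunctor M N :=
  (isCocontinuous.{w} (presheafMonics M) N).ι ⋙ (yonedaM M).precomp N

end Presheaf

end MCat

/-! Preservation of a colimit by `Par.incl` means that partial maps out of the colimit are
compatible families of partial maps out of the diagram. Restricting `(m, f)` along a total map pulls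
`m` back, so this is a descent principle for monics in `N`. It gives local recognition of pullbacks
(`isPullback_of_isColimit`), stability of colimits under pullback
(`nonempty_isColimit_of_isPullback`) and gluing of cartesian families (`descent_of_isColimit`).

Presheaves are cocomplete because a partial map of presheaves is its graph: a functional relation,
stable under restriction, whose domain meets each element in a sieve of the form "factors through
`m`" with `m ∈ M`. These conditions concern one element at a time, and each element of a colimit
comes from some stage, so graphs glue.

For the equivalence, a cocontinuous functor on presheaves is the left Kan extension of its
restriction, which settles functors and transformations without the `M`-structure. That structure
follows by descent: a monic into `Q` pulls back to some `y m` over each representable, `Q` and the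
domain are the colimits of these pieces, and the glued map in `D` is again in `N` with pullback
squares at the legs. -/

namespace MCat

/-! ### Descent along colimits in a cocomplete `M`-category. -/

section PartialMapColimits

variable {D : Type u} [Category.{v} D] {N : MorphismProperty D} [StableMonics N]

/-- Restricting a partial map along a total map is computed by pullback. -/
lemma incl_map_comp_mk {X Y Z B P : D} (g : X ⟶ Y) {n : B ⟶ Y} (hn : N n) (f : B ⟶ Z)
    {p : P ⟶ B} {q : P ⟶ X} (sq : IsPullback p q n g) :
    (PartialMap.mk (𝟙 X) (N.id_mem _) g).comp (PartialMap.mk n hn f) =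
      PartialMap.mk q (N.of_isPullback sq hn) (p ≫ f) := by
  rw [PartialMap.mk_comp_mk _ _ _ _ _ _ sq]
  exact (PartialMap.mk_eq_mk_iff _ _ _ _ _ _).2 ⟨Iso.refl _, by simp, by simp⟩

variable {J : Type u₁} [Category.{v₁} J] {K H : J ⥤ D} {c : Cocone K}
  [PreservesColimit K (Par.incl N)] (hc : IsColimit c)

include hc

/-- Partial maps out of a colimit are determined by their restrictions to the legs. -/
lemma PartialMap.ext_of_isColimit {X B B' : D} {n : B ⟶ c.pt} (hn : N n) {f : B ⟶ X}
    {n' : B' ⟶ c.pt} (hn' : N n') {f' : B' ⟶ X}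
    (h : ∀ j, ∃ (Z : D) (a : Z ⟶ B) (a' : Z ⟶ B') (b : Z ⟶ K.obj j),
      IsPullback a b n (c.ι.app j) ∧ IsPullback a' b n' (c.ι.app j) ∧ a ≫ f = a' ≫ f') :
    ∃ φ : B' ≅ B, φ.hom ≫ n = n' ∧ φ.hom ≫ f = f' := by
  rw [← PartialMap.mk_eq_mk_iff n hn f n' hn' f']
  refine (isColimitOfPreserves (Par.incl N) hc).hom_ext (W := ⟨X⟩) fun j => ?_
  obtain ⟨Z, a, a', b, sq, sq', hf⟩ := h j
  refine (incl_map_comp_mk (c.ι.app j) hn f sq).trans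
    (Eq.trans ?_ (incl_map_comp_mk (c.ι.app j) hn' f' sq').symm)
  exact (PartialMap.mk_eq_mk_iff _ _ _ _ _ _).2 ⟨Iso.refl _, by simp, by simp [hf]⟩

/-- A commutative square with vertical sides in `N`, whose bottom side starts at a colimit, is a
pullback as soon as it is one after restriction to each leg of the colimit. -/
lemma isPullback_of_isColimit {X Y Y' : D} {n : X ⟶ c.pt} (hn : N n) {n' : Y ⟶ Y'} (hn' : N n')
    {f : X ⟶ Y} {g : c.pt ⟶ Y'} (w : f ≫ n' = n ≫ g)
    (h : ∀ j, ∃ (Z : D) (a : Z ⟶ X) (b : Z ⟶ K.obj j),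
      IsPullback a b n (c.ι.app j) ∧ IsPullback (a ≫ f) b n' (c.ι.app j ≫ g)) :
    IsPullback f n n' g := by
  have : HasPullback n' g := StableMonics.hasPullback _ _ hn'
  have : Mono n' := StableMonics.mono _ hn'
  have sq := IsPullback.of_hasPullback n' g
  -- Repeating the left leg as right leg makes this a comparison of two subobjects of `c.pt`: `n`
  -- and the pullback of `n'`.
  obtain ⟨φ, hφ, -⟩ := PartialMap.ext_of_isColimit hc (f := n) (f' := pullback.snd n' g) hn
    (N.of_isPullback sq hn') (fun j => by
      obtain ⟨Z, a, b, sq₁, sq₂⟩ := h j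
      have e : (a ≫ f) ≫ n' = (b ≫ c.ι.app j) ≫ g := by simpa using sq₂.w
      refine ⟨Z, a, sq.lift (a ≫ f) (b ≫ c.ι.app j) e, b, sq₁, ?_, ?_⟩
      · exact IsPullback.of_right (by simpa using sq₂) (by simp) sq
      · rw [sq.lift_snd, sq₁.w])
  refine IsPullback.of_iso sq φ (Iso.refl _) (Iso.refl _) (Iso.refl _) ?_ (by simp [hφ])
    (by simp) (by simp)
  rw [← cancel_mono n']
  simp [w, reassoc_of% hφ, pullback.condition]

/-- A cocone under a cartesian family of `N`-subobjects of a diagram extends to a partial map out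
of the colimit of this diagram. -/
lemma exists_partialMap_of_isColimit {α : H ⟶ K} (hα : ∀ j, N (α.app j))
    (sq : ∀ ⦃i j : J⦄ (k : i ⟶ j), IsPullback (H.map k) (α.app i) (α.app j) (K.map k))
    (t : Cocone H) :
    ∃ (B : D) (n : B ⟶ c.pt) (f : B ⟶ t.pt) (b : ∀ j, H.obj j ⟶ B), N n ∧
      ∀ j, IsPullback (b j) (α.app j) n (c.ι.app j) ∧ b j ≫ f = t.ι.app j := by
  -- Cartesianness of `α` is what makes the partial maps `(α_j, t_j)` compatible.
  let s : Cocone (K ⋙ Par.incl N) :=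
    { pt := ⟨t.pt⟩
      ι :=
        { app j := PartialMap.mk (α.app j) (hα j) (t.ι.app j)
          naturality i j k := by
            refine Eq.trans ?_ (Category.comp_id _).symm
            refine (incl_map_comp_mk (K.map k) (hα j) (t.ι.app j) (sq k)).trans ?_
            rw [t.w]
            rfl } }
  have hs := (isColimitOfPreserves (Par.incl N) hc).fac s
  generalize (isColimitOfPreserves (Par.incl N) hc).desc s = d at hs
  change PartialMap N c.pt t.pt at d
  induction d using PartialMap.ind with
  | _ B n hn f =>
  have key (j : J) : ∃ b : H.obj j ⟶ B, IsPullback b (α.app j) n (c.ι.app j) ∧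
      b ≫ f = t.ι.app j := by
    have : HasPullback n (c.ι.app j) := StableMonics.hasPullback _ _ hn
    have sq := IsPullback.of_hasPullback n (c.ι.app j)
    obtain ⟨φ, h₁, h₂⟩ := (PartialMap.mk_eq_mk_iff _ _ _ _ _ _).1
      ((incl_map_comp_mk (c.ι.app j) hn f sq).symm.trans (hs j))
    refine ⟨φ.hom ≫ pullback.fst _ _, ?_, by simpa using h₂⟩
    exact IsPullback.of_iso sq φ.symm (Iso.refl _) (Iso.refl _) (Iso.refl _) (by simp)
      (by simp [← h₁]) (by simp) (by simp)
  choose b hb using key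
  exact ⟨B, n, f, b, hn, hb⟩

/-- Colimits are stable under pullback along members of `N`. -/
lemma nonempty_isColimit_of_isPullback {α : H ⟶ K} (t : Cocone H) (m : t.pt ⟶ c.pt) (hm : N m)
    (sq : ∀ j, IsPullback (t.ι.app j) (α.app j) m (c.ι.app j)) : Nonempty (IsColimit t) := by
  have : Mono m := StableMonics.mono _ hm
  have hα (j : J) : N (α.app j) := N.of_isPullback (sq j) hm
  have hsq ⦃i j : J⦄ (k : i ⟶ j) : IsPullback (H.map k) (α.app i) (α.app j) (K.map k) :=
    IsPullback.of_right (by simpa using sq i) (α.naturality k) (sq j)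
  refine ⟨IsColimit.ofExistsUnique fun s => ?_⟩
  obtain ⟨B, n, f, b, hn, hb⟩ := exists_partialMap_of_isColimit hc hα hsq s
  obtain ⟨φ, hφ, -⟩ := PartialMap.ext_of_isColimit hc (f := n) (f' := m) hn hm
    (fun j => ⟨_, b j, t.ι.app j, α.app j, (hb j).1, sq j, by rw [(hb j).1.w, (sq j).w]⟩)
  have : Mono n := StableMonics.mono _ hn
  have hι (j : J) : t.ι.app j ≫ φ.hom = b j := by
    rw [← cancel_mono n, Category.assoc, hφ, (sq j).w, (hb j).1.w]
  refine ⟨φ.hom ≫ f, fun j => by rw [reassoc_of% hι, (hb j).2], fun g hg => ?_⟩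
  -- Uniqueness: `g` and `φ.hom ≫ f` are right legs over the same `m`, and the comparison
  -- isomorphism is trivial since `m` is monic.
  obtain ⟨ψ, h₁, h₂⟩ := PartialMap.ext_of_isColimit hc (f := g) (f' := φ.hom ≫ f) hm hm
    (fun j => ⟨_, t.ι.app j, t.ι.app j, α.app j, sq j, sq j, by
      rw [hg, reassoc_of% hι, (hb j).2]⟩)
  have : ψ.hom = 𝟙 _ := by rw [← cancel_mono m, h₁, Category.id_comp]
  rw [← h₂, this, Category.id_comp]

/-- The map induced on colimits by a cartesian family of members of `N` is in `N`, and the squares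
at the legs of the colimits are pullbacks. -/
lemma descent_of_isColimit {α : H ⟶ K} (hα : ∀ j, N (α.app j))
    (sq : ∀ ⦃i j : J⦄ (k : i ⟶ j), IsPullback (H.map k) (α.app i) (α.app j) (K.map k))
    {t : Cocone H} (ht : IsColimit t) (m : t.pt ⟶ c.pt)
    (hm : ∀ j, t.ι.app j ≫ m = α.app j ≫ c.ι.app j) :
    N m ∧ ∀ j, IsPullback (t.ι.app j) (α.app j) m (c.ι.app j) := by
  -- With the colimit cocone `t` itself as target, `f` becomes the candidate inverse of the
  -- comparison `t.pt ⟶ B`.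
  obtain ⟨B, n, f, b, hn, hb⟩ := exists_partialMap_of_isColimit hc hα sq t
  have : Mono n := StableMonics.mono _ hn
  have hb' (i j : J) (k : i ⟶ j) : H.map k ≫ b j = b i := by
    rw [← cancel_mono n]
    simp [(hb j).1.w, (hb i).1.w]
  let g : t.pt ⟶ B := ht.desc ⟨B, { app := b, naturality := by simp [hb'] }⟩
  have hg (j : J) : t.ι.app j ≫ g = b j := ht.fac _ j
  have h₁ : g ≫ f = 𝟙 _ := ht.hom_ext fun j => by
    rw [reassoc_of% hg, (hb j).2, Category.comp_id]
  have h₂ : g ≫ n = m := ht.hom_ext fun j => by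
    rw [reassoc_of% hg, (hb j).1.w, hm]
  -- `B` is not known to be a colimit, so the two endomorphisms of `B` are compared as partial maps
  -- out of `c.pt`.
  have h₃ : f ≫ g = 𝟙 _ := by
    obtain ⟨φ, h, h'⟩ := PartialMap.ext_of_isColimit hc (f := f ≫ g) (f' := 𝟙 _) hn hn
      (fun j => ⟨_, b j, b j, α.app j, (hb j).1, (hb j).1, by
        rw [reassoc_of% (hb j).2, hg, Category.comp_id]⟩)
    have : φ.hom = 𝟙 _ := by rw [← cancel_mono n, h, Category.id_comp]
    simpa [this] using h'
  let e : t.pt ≅ B := ⟨g, f, h₁, h₃⟩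
  refine ⟨h₂ ▸ N.comp_mem g n (StableMonics.of_isIso g e.isIso_hom) hn, fun j => ?_⟩
  exact IsPullback.of_iso (hb j).1 (Iso.refl _) e.symm (Iso.refl _) (Iso.refl _)
    (by simp [e, (hb j).2]) (by simp) (by simp [e, ← h₂, reassoc_of% h₃]) (by simp)

end PartialMapColimits

/-! ### Graphs of partial maps, and cocompleteness of presheaves. -/

section PresheafCocomplete

variable {C : Type w} [SmallCategory.{w} C]

lemma presheaf_isPullback_iff {P X Y Z : Cᵒᵖ ⥤ Type w} {p : P ⟶ X} {n : P ⟶ Y} {m : X ⟶ Z}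
    {f : Y ⟶ Z} : IsPullback p n m f ↔
      ∀ c, IsPullback (p.app c) (n.app c) (m.app c) (f.app c) := by
  refine ⟨fun h c => h.map ((evaluation _ _).obj c), fun h => ⟨⟨?_⟩, ⟨?_⟩⟩⟩
  · ext c : 2
    exact (h c).w
  · refine evaluationJointlyReflectsLimits _ fun c => ?_
    exact (isLimitMapConePullbackConeEquiv ((evaluation _ _).obj c) _).symm (h c).isLimit

variable {M : MorphismProperty C}

/-- The graph of a partial map of presheaves. -/
def PartialMap.graph {P X : Cᵒᵖ ⥤ Type w} (a : PartialMap (presheafMonics M) P X) (c : Cᵒᵖ)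
    (p : P.obj c) : Set (X.obj c) :=
  Quotient.lift (s := PartialSpan.setoid _ P X)
    (fun s => {x | ∃ z : s.dom.obj c, s.m.app c z = p ∧ s.f.app c z = x}) (by
      rintro s t ⟨φ, h₁, h₂⟩
      ext x
      constructor
      · rintro ⟨z, rfl, rfl⟩
        exact ⟨φ.inv.app c z, by simp [← h₁], by simp [← h₂]⟩
      · rintro ⟨z, rfl, rfl⟩
        exact ⟨φ.hom.app c z, by simp [← h₁], by simp [← h₂]⟩) a

lemma PartialMap.mem_graph_mk {P X Z : Cᵒᵖ ⥤ Type w} {m : Z ⟶ P} (hm : presheafMonics M m)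
    (f : Z ⟶ X) (c : Cᵒᵖ) (p : P.obj c) (x : X.obj c) :
    x ∈ (PartialMap.mk m hm f).graph c p ↔ ∃ z : Z.obj c, m.app c z = p ∧ f.app c z = x :=
  Iff.rfl

lemma PartialMap.map_mem_graph {P X : Cᵒᵖ ⥤ Type w} (a : PartialMap (presheafMonics M) P X)
    {c d : Cᵒᵖ} (g : c ⟶ d) {p : P.obj c} {x : X.obj c} (h : x ∈ a.graph c p) :
    X.map g x ∈ a.graph d (P.map g p) := by
  induction a using PartialMap.ind with
  | _ Z m hm f =>
  obtain ⟨z, rfl, rfl⟩ := h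
  exact ⟨Z.map g z, by simp [NatTrans.naturality_apply], by simp [NatTrans.naturality_apply]⟩

/-- By Yoneda `p` is a map out of `y B`; the domain pulls back along it to `y m`, so a restriction
of `p` lies in the domain exactly when it factors through `m`. -/
lemma PartialMap.exists_graph_nonempty_iff {P X : Cᵒᵖ ⥤ Type w}
    (a : PartialMap (presheafMonics M) P X) (B : C) (p : P.obj (.op B)) :
    ∃ (A : C) (m : A ⟶ B), M m ∧ ∀ (d : C) (g : d ⟶ B),
      (a.graph (.op d) (P.map g.op p)).Nonempty ↔ ∃ h : d ⟶ A, h ≫ m = g := by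
  induction a using PartialMap.ind with
  | _ Z μ hμ f =>
  obtain ⟨A, m, q, hm, sq⟩ := hμ (yonedaEquiv.symm p)
  refine ⟨A, m, hm, fun d g => ?_⟩
  have sq' := presheaf_isPullback_iff.1 sq (.op d)
  constructor
  · rintro ⟨_, z, hz, rfl⟩
    obtain ⟨h, -, rfl⟩ := Types.exists_of_isPullback sq' z g (by simpa [yonedaEquiv] using hz)
    exact ⟨h, rfl⟩
  · rintro ⟨h, rfl⟩
    refine ⟨_, q.app _ h, ?_, rfl⟩
    have := ConcreteCategory.congr_hom sq'.w h
    simpa [yonedaEquiv] using this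

variable [StableMonics M]

lemma presheafMonics_app_injective {P Q : Cᵒᵖ ⥤ Type w} {μ : P ⟶ Q} (h : presheafMonics M μ)
    (c : Cᵒᵖ) : Function.Injective (μ.app c) := by
  have : Mono μ := StableMonics.mono _ h
  rw [← mono_iff_injective]
  infer_instance

lemma PartialMap.subsingleton_graph {P X : Cᵒᵖ ⥤ Type w} (a : PartialMap (presheafMonics M) P X)
    (c : Cᵒᵖ) (p : P.obj c) : (a.graph c p).Subsingleton := by
  induction a using PartialMap.ind with
  | _ Z m hm f =>
  rintro _ ⟨z, rfl, rfl⟩ _ ⟨z', h, rfl⟩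
  rw [presheafMonics_app_injective hm c h]

/-- Pullbacks of presheaves are pointwise. This turns the cocone identities in `Par` into equalities
of graphs. -/
lemma PartialMap.graph_incl_comp {P Q X : Cᵒᵖ ⥤ Type w} (g : P ⟶ Q)
    (a : PartialMap (presheafMonics M) Q X) (c : Cᵒᵖ) (p : P.obj c) :
    ((PartialMap.mk (𝟙 P) ((presheafMonics M).id_mem _) g).comp a).graph c p =
      a.graph c (g.app c p) := by
  induction a using PartialMap.ind with
  | _ Z μ hμ f =>
  have sq := IsPullback.of_hasPullback μ g
  have sq' := presheaf_isPullback_iff.1 sq c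
  rw [incl_map_comp_mk g hμ f sq]
  ext x
  rw [mem_graph_mk, mem_graph_mk]
  constructor
  · rintro ⟨z, rfl, rfl⟩
    exact ⟨_, ConcreteCategory.congr_hom sq'.w z, rfl⟩
  · rintro ⟨z, h, rfl⟩
    obtain ⟨y, rfl, rfl⟩ := Types.exists_of_isPullback sq' z p h
    exact ⟨y, rfl, rfl⟩

/-- Since `n` is pointwise injective, the chosen lifts are unique and hence natural. -/
lemma exists_hom_of_forall_exists {P X Z Z' : Cᵒᵖ ⥤ Type w} {m : Z ⟶ P} {f : Z ⟶ X} {n : Z' ⟶ P}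
    (hn : presheafMonics M n) {g : Z' ⟶ X}
    (h : ∀ c (z : Z.obj c), ∃ z' : Z'.obj c, n.app c z' = m.app c z ∧ g.app c z' = f.app c z) :
    ∃ φ : Z ⟶ Z', φ ≫ n = m ∧ φ ≫ g = f := by
  choose φ h₁ h₂ using h
  refine ⟨{ app c := ↾(φ c), naturality c d k := ?_ }, ?_, ?_⟩
  · ext z
    apply presheafMonics_app_injective hn d
    simp [h₁, NatTrans.naturality_apply]
  · ext c z
    exact h₁ c z
  · ext c z
    exact h₂ c z

/-- A partial map of presheaves is determined by its graph. -/
lemma PartialMap.graph_injective {P X : Cᵒᵖ ⥤ Type w} {a b : PartialMap (presheafMonics M) P X}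
    (h : ∀ c p, a.graph c p = b.graph c p) : a = b := by
  induction a using PartialMap.ind with
  | _ Z m hm f =>
  induction b using PartialMap.ind with
  | _ Z' n hn g =>
  obtain ⟨φ, h₁, h₂⟩ := exists_hom_of_forall_exists (m := m) (f := f) hn (g := g) fun c z => by
    have : f.app c z ∈ (PartialMap.mk m hm f).graph c (m.app c z) := ⟨z, rfl, rfl⟩
    rwa [h] at this
  obtain ⟨ψ, h₃, h₄⟩ := exists_hom_of_forall_exists (m := n) (f := g) hm (g := f) fun c z => by
    have : g.app c z ∈ (PartialMap.mk n hn g).graph c (n.app c z) := ⟨z, rfl, rfl⟩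
    rwa [← h] at this
  have : Mono m := StableMonics.mono _ hm
  have : Mono n := StableMonics.mono _ hn
  rw [PartialMap.mk_eq_mk_iff]
  exact ⟨⟨ψ, φ, by simp [← cancel_mono n, h₁, h₃], by simp [← cancel_mono m, h₁, h₃]⟩, h₃, h₄⟩

/-- A family of relations which is functional, stable under restriction, and whose domain is
classified by members of `M`, is the graph of a partial map. -/
lemma PartialMap.exists_of_graph {P X : Cᵒᵖ ⥤ Type w} (ρ : ∀ c, P.obj c → Set (X.obj c))
    (h₀ : ∀ c p, (ρ c p).Subsingleton)
    (h₁ : ∀ {c d : Cᵒᵖ} (g : c ⟶ d) {p : P.obj c} {x : X.obj c},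
      x ∈ ρ c p → X.map g x ∈ ρ d (P.map g p))
    (h₂ : ∀ (B : C) (p : P.obj (.op B)), ∃ (A : C) (m : A ⟶ B), M m ∧ ∀ (d : C) (g : d ⟶ B),
      (ρ (.op d) (P.map g.op p)).Nonempty ↔ ∃ h : d ⟶ A, h ≫ m = g) :
    ∃ a : PartialMap (presheafMonics M) P X, ∀ c p, a.graph c p = ρ c p := by
  let Z : Cᵒᵖ ⥤ Type w :=
    { obj c := { z : P.obj c × X.obj c // z.2 ∈ ρ c z.1 }
      map g := ↾fun z => ⟨(P.map g z.1.1, X.map g z.1.2), h₁ g z.2⟩ }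
  let μ : Z ⟶ P := { app c := ↾fun z => z.1.1 }
  let f : Z ⟶ X := { app c := ↾fun z => z.1.2 }
  have hμ : presheafMonics M μ := fun B γ => by
    obtain ⟨p, rfl⟩ := yonedaEquiv.symm.surjective γ
    obtain ⟨A, m, hm, h⟩ := h₂ B p
    have : Mono m := StableMonics.mono _ hm
    -- The value of the relation at the restriction of `p` along `m` classifies the map `y A ⟶ Z`;
    -- functionality then fixes all further values.
    obtain ⟨x, hx⟩ := (h A m).2 ⟨𝟙 _, by simp⟩
    let z : Z.obj (.op A) := ⟨(P.map m.op p, x), hx⟩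
    refine ⟨A, m, yonedaEquiv.symm z, hm, presheaf_isPullback_iff.2 fun c => ?_⟩
    rw [Types.isPullback_iff]
    refine ⟨?_, ?_, ?_⟩
    · ext k
      simp [yonedaEquiv, z, Z, μ]
    · rintro k k' ⟨-, hk⟩
      exact (cancel_mono m).1 hk
    · rintro ⟨⟨p', x'⟩, hx'⟩ g hg
      obtain rfl : p' = P.map g.op p := by simpa [yonedaEquiv, μ] using hg
      obtain ⟨k, rfl⟩ := (h c.unop g).1 ⟨x', hx'⟩
      refine ⟨k, ?_, rfl⟩
      have := h₁ k.op hx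
      rw [← Functor.map_comp_apply, ← op_comp] at this
      refine Subtype.ext (Prod.ext ?_ ?_)
      · simp [yonedaEquiv, z, Z]
      · exact h₀ _ _ this hx'
  refine ⟨PartialMap.mk μ hμ f, fun c p => ?_⟩
  ext x
  rw [mem_graph_mk]
  constructor
  · rintro ⟨z, rfl, rfl⟩
    exact z.2
  · exact fun hx => ⟨⟨(p, x), hx⟩, rfl, rfl⟩

/-- The target may live in any universe, as is needed when it is a hom-set of `D`. -/
lemma exists_desc_of_isColimit {J : Type u₁} [Category.{v₁} J] {K : J ⥤ Type u} {c : Cocone K}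
    (hc : IsColimit c) {T : Type v} (t : ∀ j, K.obj j → T)
    (ht : ∀ {i j : J} (k : i ⟶ j) (x : K.obj i), t j (K.map k x) = t i x) :
    ∃ f : c.pt → T, ∀ j x, f (c.ι.app j x) = t j x := by
  have h := (Types.isColimit_iff_coconeTypesIsColimit c).1 ⟨hc⟩
  let t' : K.CoconeTypes := { pt := T, ι := t, ι_naturality := fun k => funext (ht k) }
  exact ⟨h.desc t', fun j x => h.fac_apply t' j x⟩

/-- The inclusion of presheaves into partial maps of presheaves preserves all colimits. -/
lemma preservesColimit_presheaf_incl {J : Type w} [SmallCategory.{w} J]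
    (K : J ⥤ Cᵒᵖ ⥤ Type w) : PreservesColimit K (Par.incl (presheafMonics M)) where
  preserves {c} hc := by
    have hc' (d : Cᵒᵖ) := isColimitOfPreserves ((evaluation _ _).obj d) hc
    have surj (d : Cᵒᵖ) (p : c.pt.obj d) : ∃ (j : J) (x : (K.obj j).obj d),
        (c.ι.app j).app d x = p := Types.jointly_surjective_of_isColimit (hc' d) p
    refine ⟨IsColimit.ofExistsUnique fun s => ?_⟩
    let a (j : J) : PartialMap (presheafMonics M) (K.obj j) s.pt.obj := s.ι.app j
    have ha {i j : J} (k : i ⟶ j) (d : Cᵒᵖ) (x : (K.obj i).obj d) :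
        (a j).graph d ((K.map k).app d x) = (a i).graph d x := by
      have : (PartialMap.mk (𝟙 _) ((presheafMonics M).id_mem _) (K.map k)).comp (a j) = a i :=
        s.w k
      rw [← PartialMap.graph_incl_comp, this]
    have key (d : Cᵒᵖ) : ∃ ρ : c.pt.obj d → Set (s.pt.obj.obj d),
        ∀ (j : J) (x : (K.obj j).obj d), ρ ((c.ι.app j).app d x) = (a j).graph d x :=
      exists_desc_of_isColimit (hc' d) (fun j x => (a j).graph d x) (fun k x => ha k d x)
    choose ρ hρ using key
    have hρ' (j : J) {d e : Cᵒᵖ} (g : d ⟶ e) (x : (K.obj j).obj d) :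
        ρ e (c.pt.map g ((c.ι.app j).app d x)) = (a j).graph e ((K.obj j).map g x) := by
      rw [← NatTrans.naturality_apply, hρ]
    -- Each graph condition at `p` is inherited from an element `x` of some `K.obj j` lying over
    -- `p`.
    obtain ⟨b, hb⟩ := PartialMap.exists_of_graph (M := M) ρ
      (fun d p => by
        obtain ⟨j, x, rfl⟩ := surj d p
        rw [hρ]
        exact (a j).subsingleton_graph d x)
      (fun {d e} g p y hy => by
        obtain ⟨j, x, rfl⟩ := surj d p
        rw [hρ] at hy
        rw [hρ']
        exact (a j).map_mem_graph g hy)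
      (fun B p => by
        obtain ⟨j, x, rfl⟩ := surj _ p
        obtain ⟨A, m, hm, h⟩ := (a j).exists_graph_nonempty_iff B x
        exact ⟨A, m, hm, fun d g => by rw [hρ', h]⟩)
    refine ⟨b, fun j => ?_, fun b' hb' => ?_⟩
    · refine PartialMap.graph_injective (b := a j) fun d x => ?_
      exact (PartialMap.graph_incl_comp (c.ι.app j) b d x).trans (by rw [hb, hρ])
    · change PartialMap (presheafMonics M) c.pt s.pt.obj at b'
      refine PartialMap.graph_injective (a := b') fun d p => ?_
      obtain ⟨j, x, rfl⟩ := surj d p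
      rw [hb, hρ, ← PartialMap.graph_incl_comp]
      exact congrArg (fun e : PartialMap (presheafMonics M) _ _ => e.graph d x) (hb' j)

variable (M)

/-- The `M`-category of presheaves is cocomplete. -/
lemma isCocomplete_presheafMonics : IsCocomplete.{w} (presheafMonics M) where
  hasColimits := inferInstance
  preservesColimits := ⟨⟨fun {K} => preservesColimit_presheaf_incl K⟩⟩

end PresheafCocomplete

/-! ### Pulling a cocone back along a map into its point. -/

section PullbackDiagram

variable {D : Type u} [Category.{v} D] {J : Type u₁} [Category.{v₁} J] {K : J ⥤ D} {c : Cocone K}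
  {B : D} {n : B ⟶ c.pt} {R : J → D} {a : ∀ j, R j ⟶ B} {b : ∀ j, R j ⟶ K.obj j}
  (sq : ∀ j, IsPullback (a j) (b j) n (c.ι.app j))

/-- Chosen pullbacks of the legs of a cocone along a map into its point, as a diagram. -/
@[simps obj]
noncomputable def pullbackDiagram : J ⥤ D where
  obj := R
  map {i j} k := (sq j).lift (a i) (b i ≫ K.map k) (by simpa using (sq i).w)
  map_id i := (sq i).hom_ext (by simp) (by simp)
  map_comp k l := (sq _).hom_ext (by simp) (by simp)

/-- The projection from the pulled back diagram to the original one. -/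
@[simps]
noncomputable def pullbackDiagramSnd : pullbackDiagram sq ⟶ K where
  app := b
  naturality _ _ _ := by simp [pullbackDiagram]

/-- The pulled back cocone. -/
@[simps]
noncomputable def pullbackCocone : Cocone (pullbackDiagram sq) where
  pt := B
  ι :=
    { app := a
      naturality _ _ _ := by simp [pullbackDiagram] }

lemma isPullback_pullbackDiagram_map {i j : J} (k : i ⟶ j) :
    IsPullback ((pullbackDiagram sq).map k) (b i) (b j) (K.map k) :=
  IsPullback.of_right (by simpa [pullbackDiagram] using sq i)
    ((pullbackDiagramSnd sq).naturality k) (sq j)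

end PullbackDiagram

/-! ### Cocontinuous extensions of `M`-functors are `M`-functors. -/

section Extension

variable {C : Type w} [SmallCategory.{w} C] {M : MorphismProperty C} [StableMonics M]
  {D : Type u} [Category.{v} D] {N : MorphismProperty D} [StableMonics N]
  {T : (Cᵒᵖ ⥤ Type w) ⥤ D}

/-- A functor on presheaves whose restriction to `C` is an `M`-functor behaves like an `M`-functor
on pullback squares over maps of representables. -/
lemma map_isPullback_of_representable
    (hT : ∀ {X Y : C} (m : X ⟶ Y), M m → N (T.map (yoneda.map m)))
    (hT' : ∀ {P X Y Z : C} {p : P ⟶ X} {n : P ⟶ Y} {m : X ⟶ Z} {f : Y ⟶ Z}, M m →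
      IsPullback p n m f → IsPullback (T.map (yoneda.map p)) (T.map (yoneda.map n))
        (T.map (yoneda.map m)) (T.map (yoneda.map f)))
    {X Y : C} {R R' : Cᵒᵖ ⥤ Type w} {ν : R ⟶ yoneda.obj Y} (hν : presheafMonics M ν)
    {a : R' ⟶ R} {ν' : R' ⟶ yoneda.obj X} {g : X ⟶ Y} (sq : IsPullback a ν' ν (yoneda.map g)) :
    N (T.map ν) ∧ IsPullback (T.map a) (T.map ν') (T.map ν) (T.map (yoneda.map g)) := by
  -- Testing `ν` against the identity shows that it is isomorphic to some `y m`.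
  obtain ⟨A, m, p, hm, sq₁⟩ := hν (𝟙 _)
  have : IsIso p := sq₁.isIso_fst_of_isIso
  have hp : p ≫ ν = yoneda.map m := by simpa using sq₁.w
  have : HasPullback m g := StableMonics.hasPullback _ _ hm
  have sq₂ := IsPullback.of_hasPullback m g
  have sq₃ : IsPullback (yoneda.map (pullback.fst m g) ≫ p) (yoneda.map (pullback.snd m g)) ν
      (yoneda.map g) :=
    IsPullback.of_iso (sq₂.map yoneda) (Iso.refl _) (asIso p) (Iso.refl _) (Iso.refl _)
      (Category.id_comp _).symm
      ((Category.comp_id _).trans (Category.id_comp _).symm) ((Category.comp_id _).trans hp.symm)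
      ((Category.comp_id _).trans (Category.id_comp _).symm)
  let e : yoneda.obj (pullback m g) ≅ R' := sq₃.isoIsPullback _ _ sq
  constructor
  · have hν' : T.map ν = T.map (inv p) ≫ T.map (yoneda.map m) := by
      rw [← hp, ← T.map_comp, IsIso.inv_hom_id_assoc]
    rw [hν']
    exact N.comp_mem _ _ (StableMonics.of_isIso _ inferInstance) (hT m hm)
  · refine IsPullback.of_iso (hT' hm sq₂) (T.mapIso e) (T.mapIso (asIso p)) (Iso.refl _)
      (Iso.refl _) ?_ ?_ ?_ (by simp)
    · simp only [Functor.mapIso_hom, asIso_hom, ← T.map_comp]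
      exact congrArg T.map (by simp [e])
    · simp only [Functor.mapIso_hom, Iso.refl_hom, Category.comp_id, ← T.map_comp]
      exact congrArg T.map (by simp [e])
    · simp only [Functor.mapIso_hom, asIso_hom, Iso.refl_hom, Category.comp_id, ← T.map_comp]
      exact congrArg T.map hp.symm

/-- A cocontinuous functor on presheaves whose restriction to `C` is an `M`-functor sends members
of `M` into `N` and preserves their pullbacks along maps out of representables. -/
lemma map_mem_and_isPullback_of_preservesColimits [PreservesColimitsOfSize.{w, w} T]
    [PreservesColimitsOfSize.{w, w} (Par.incl N)]
    (hT : ∀ {X Y : C} (m : X ⟶ Y), M m → N (T.map (yoneda.map m)))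
    (hT' : ∀ {P X Y Z : C} {p : P ⟶ X} {n : P ⟶ Y} {m : X ⟶ Z} {f : Y ⟶ Z}, M m →
      IsPullback p n m f → IsPullback (T.map (yoneda.map p)) (T.map (yoneda.map n))
        (T.map (yoneda.map m)) (T.map (yoneda.map f)))
    {P Q : Cᵒᵖ ⥤ Type w} {μ : P ⟶ Q} (hμ : presheafMonics M μ) :
    N (T.map μ) ∧ ∀ {X : C} {R : Cᵒᵖ ⥤ Type w} {a : R ⟶ P} {ν : R ⟶ yoneda.obj X}
      {γ : yoneda.obj X ⟶ Q}, IsPullback a ν μ γ →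
        IsPullback (T.map a) (T.map ν) (T.map μ) (T.map γ) := by
  let c := Presheaf.tautologicalCocone Q
  let hc : IsColimit c := Presheaf.isColimitTautologicalCocone Q
  have : PreservesColimit (CostructuredArrow.proj yoneda Q ⋙ yoneda)
      (Par.incl (presheafMonics M)) := preservesColimit_presheaf_incl _
  obtain ⟨R, a, b, sq⟩ : ∃ (R : CostructuredArrow yoneda Q → Cᵒᵖ ⥤ Type w) (a : ∀ j, R j ⟶ P)
      (b : ∀ j, R j ⟶ yoneda.obj j.left), ∀ j, IsPullback (a j) (b j) μ (c.ι.app j) :=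
    ⟨_, _, _, fun j => IsPullback.of_hasPullback μ (c.ι.app j)⟩
  have hb (j) : presheafMonics M (b j) := (presheafMonics M).of_isPullback (sq j) hμ
  obtain ⟨ht⟩ := nonempty_isColimit_of_isPullback (α := pullbackDiagramSnd (c := c) (n := μ) sq) hc
    (pullbackCocone (c := c) (n := μ) sq) μ hμ sq
  have key (i j) (k : i ⟶ j) := map_isPullback_of_representable hT hT' (hb j)
    (isPullback_pullbackDiagram_map (c := c) (n := μ) sq k)
  obtain ⟨h₁, h₂⟩ := descent_of_isColimit (N := N) (isColimitOfPreserves T hc)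
    (α := Functor.whiskerRight (pullbackDiagramSnd (c := c) (n := μ) sq) T)
    (fun j => (key j j (𝟙 j)).1) (fun i j k => (key i j k).2) (isColimitOfPreserves T ht)
    (T.map μ) (fun j => (T.map_comp _ _).symm.trans
      ((congrArg T.map (sq j).w).trans (T.map_comp _ _)))
  refine ⟨h₁, fun {X R' a' ν γ} hsq => ?_⟩
  -- `γ` is itself a leg of the tautological cocone, so the given square is isomorphic to the chosen
  -- one at that index.
  have hγ := sq (CostructuredArrow.mk γ)
  let e : R' ≅ R (CostructuredArrow.mk γ) := hsq.isoIsPullback _ _ hγ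
  refine IsPullback.of_iso (h₂ (CostructuredArrow.mk γ)) (T.mapIso e.symm) (Iso.refl _)
    (Iso.refl _) (Iso.refl _) ?_ ?_ ?_ ?_
  · exact (Category.comp_id _).trans ((congrArg T.map
      (hsq.isoIsPullback_inv_fst _ _ hγ).symm).trans (T.map_comp _ _))
  · exact (Category.comp_id _).trans ((congrArg T.map
      (hsq.isoIsPullback_inv_snd _ _ hγ).symm).trans (T.map_comp _ _))
  · exact (Category.comp_id _).trans (Category.id_comp _).symm
  · exact (Category.comp_id _).trans (Category.id_comp _).symm

/-- A cocontinuous functor on presheaves whose restriction to `C` is an `M`-functor is itself an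
`M`-functor. -/
def MFunctor.ofPreservesColimits (T : (Cᵒᵖ ⥤ Type w) ⥤ D) [PreservesColimitsOfSize.{w, w} T]
    [PreservesColimitsOfSize.{w, w} (Par.incl N)]
    (hT : ∀ {X Y : C} (m : X ⟶ Y), M m → N (T.map (yoneda.map m)))
    (hT' : ∀ {P X Y Z : C} {p : P ⟶ X} {n : P ⟶ Y} {m : X ⟶ Z} {f : Y ⟶ Z}, M m →
      IsPullback p n m f → IsPullback (T.map (yoneda.map p)) (T.map (yoneda.map n))
        (T.map (yoneda.map m)) (T.map (yoneda.map f))) :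
    MFunctor (presheafMonics M) N where
  toFunctor := T
  map_mem _ hμ := (map_mem_and_isPullback_of_preservesColimits hT hT' hμ).1
  map_isPullback {P' P Q' Q p μ' μ f} hμ sq := by
    have hμ' := (presheafMonics M).of_isPullback sq hμ
    have h := map_mem_and_isPullback_of_preservesColimits hT hT' hμ
    have h' := map_mem_and_isPullback_of_preservesColimits hT hT' hμ'
    -- It suffices to test over representables mapping to `Q'`: there the pullback of `μ'`, and its
    -- pasting with `sq`, are both preserved by `T`.
    refine isPullback_of_isColimit
      (isColimitOfPreserves T (Presheaf.isColimitTautologicalCocone Q')) h'.1 h.1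
      (by rw [← T.map_comp, sq.w, T.map_comp]; rfl) fun j => ?_
    have sqj := IsPullback.of_hasPullback μ' j.hom
    refine ⟨_, _, _, h'.2 sqj, ?_⟩
    have := h.2 (sqj.paste_horiz sq)
    rw [T.map_comp, T.map_comp] at this
    exact this

end Extension

/-! ### Cocontinuity and left Kan extension along Yoneda. -/

section YonedaExtension

variable {C : Type w} [SmallCategory.{w} C] {D : Type u} [Category.{v} D]

/-- A cocontinuous functor on presheaves is the left Kan extension of its restriction along the
Yoneda embedding. -/
lemma isLeftKanExtension_of_preservesColimits (L : (Cᵒᵖ ⥤ Type w) ⥤ D)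
    [PreservesColimitsOfSize.{w, w} L] : L.IsLeftKanExtension (𝟙 (yoneda ⋙ L)) := by
  apply Functor.LeftExtension.IsPointwiseLeftKanExtension.isLeftKanExtension
    (E := Functor.LeftExtension.mk L (𝟙 (yoneda ⋙ L)))
  intro P
  -- The Kan extension cocone at `P` is the image under `L` of the tautological cocone.
  refine IsColimit.ofIsoColimit (isColimitOfPreserves L (Presheaf.isColimitTautologicalCocone P))
    (Cocone.ext (Iso.refl _) fun j => ?_)
  exact (Category.comp_id _).trans (Category.id_comp _).symm

/-- A pointwise left Kan extension along the Yoneda embedding is cocontinuous. -/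
lemma preservesColimits_of_isPointwiseLeftKanExtension {F : C ⥤ D} {L : (Cᵒᵖ ⥤ Type w) ⥤ D}
    {α : F ⟶ yoneda ⋙ L} (hL : (Functor.LeftExtension.mk L α).IsPointwiseLeftKanExtension) :
    PreservesColimitsOfSize.{w, w} L where
  preservesColimitsOfShape {J _} := ⟨fun {K} => ⟨fun {c} hc => ⟨by
    -- Maps out of `L.obj P` are compatible families indexed by the elements of `P`. As colimits of
    -- presheaves are pointwise, a cocone under `K ⋙ L` glues to such a family on `c.pt`.
    have hL_ext {P : Cᵒᵖ ⥤ Type w} {Y : D} {f g : L.obj P ⟶ Y} (h : ∀ (X : C)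
        (x : yoneda.obj X ⟶ P), α.app X ≫ L.map x ≫ f = α.app X ≫ L.map x ≫ g) : f = g :=
      (hL P).hom_ext fun j => (Category.assoc _ _ _).trans
        ((h j.left j.hom).trans (Category.assoc _ _ _).symm)
    have hL_desc {P : Cᵒᵖ ⥤ Type w} {Y : D} (r : ∀ X : C, (yoneda.obj X ⟶ P) → (F.obj X ⟶ Y))
        (hr : ∀ {X X' : C} (k : X ⟶ X') (x : yoneda.obj X' ⟶ P),
          r X (yoneda.map k ≫ x) = F.map k ≫ r X' x) :
        ∃ d : L.obj P ⟶ Y, ∀ (X : C) (x : yoneda.obj X ⟶ P),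
          α.app X ≫ L.map x ≫ d = r X x := by
      let t : Cocone (CostructuredArrow.proj yoneda P ⋙ F) :=
        { pt := Y
          ι :=
            { app X := r X.left X.hom
              naturality X X' k := by
                have hk : yoneda.map k.left ≫ X'.hom = X.hom := CostructuredArrow.w k
                rw [← hk, hr]
                exact (Category.comp_id _).symm } }
      exact ⟨(hL P).desc t, fun X x => (Category.assoc _ _ _).symm.trans
        ((hL P).fac t (CostructuredArrow.mk x))⟩
    have surj (d : Cᵒᵖ) (p : c.pt.obj d) : ∃ (j : J) (x : (K.obj j).obj d),
        (c.ι.app j).app d x = p :=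
      Types.jointly_surjective_of_isColimit (isColimitOfPreserves ((evaluation _ _).obj d) hc) p
    have surj' (X : C) (x : yoneda.obj X ⟶ c.pt) : ∃ (j : J) (y : yoneda.obj X ⟶ K.obj j),
        y ≫ c.ι.app j = x := by
      obtain ⟨j, y, h⟩ := surj _ (yonedaEquiv x)
      exact ⟨j, yonedaEquiv.symm y, yonedaEquiv.injective (by simp [yonedaEquiv_comp, h])⟩
    refine IsColimit.ofExistsUnique fun s => ?_
    have key (X : C) : ∃ r : c.pt.obj (.op X) → (F.obj X ⟶ s.pt), ∀ j x,
        r ((c.ι.app j).app _ x) = α.app X ≫ L.map (yonedaEquiv.symm x) ≫ s.ι.app j :=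
      exists_desc_of_isColimit (isColimitOfPreserves ((evaluation _ _).obj (.op X)) hc)
        (fun j (x : (K.obj j).obj (.op X)) => α.app X ≫ L.map (yonedaEquiv.symm x) ≫ s.ι.app j)
        (fun {i j} k x => by
          have h := s.w k
          have : yonedaEquiv.symm ((K.map k).app _ x) = yonedaEquiv.symm x ≫ K.map k :=
            yonedaEquiv.injective (by simp [yonedaEquiv_comp])
          simp only [Functor.comp_map] at h
          erw [this]
          rw [← h, L.map_comp, Category.assoc])
    choose r hr using key
    have hr' (X : C) (j : J) (x : yoneda.obj X ⟶ K.obj j) :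
        r X (yonedaEquiv (x ≫ c.ι.app j)) = α.app X ≫ L.map x ≫ s.ι.app j := by
      rw [yonedaEquiv_comp, hr, Equiv.symm_apply_apply]
    obtain ⟨d, hd⟩ := hL_desc (fun X x => r X (yonedaEquiv x)) (fun {X X'} k x => by
      obtain ⟨j, y, rfl⟩ := surj' _ x
      have := α.naturality_assoc k (L.map y ≫ s.ι.app j)
      rw [← Category.assoc, hr', hr', this, L.map_comp, Category.assoc]
      rfl)
    refine ⟨d, fun j => hL_ext fun X x => ?_, fun g hg => hL_ext fun X x => ?_⟩
    · rw [← hr', ← hd, L.map_comp, Category.assoc]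
      rfl
    · obtain ⟨j, y, rfl⟩ := surj' X x
      rw [hd, hr', ← hg j, L.map_comp, Category.assoc]
      rfl⟩⟩⟩

end YonedaExtension

/-! ### Cartesian transformations and the equivalence. -/

section Equivalence

/-- The structure of an `M`-functor is transported along a natural isomorphism. -/
def MFunctor.ofIso {C : Type u₁} [Category.{v₁} C] {M : MorphismProperty C}
    {D : Type u₂} [Category.{v₂} D] {N : MorphismProperty D} [StableMonics N]
    (F : MFunctor M N) {G : C ⥤ D} (e : F.toFunctor ≅ G) : MFunctor M N where
  toFunctor := G
  map_mem m hm := by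
    rw [← NatIso.naturality_1 e m]
    exact N.comp_mem _ _ (StableMonics.of_isIso _ inferInstance)
      (N.comp_mem _ _ (F.map_mem m hm) (StableMonics.of_isIso _ inferInstance))
  map_isPullback hm sq := IsPullback.of_iso (F.map_isPullback hm sq) (e.app _) (e.app _) (e.app _)
    (e.app _) (by simp) (by simp) (by simp) (by simp)

/-- A natural isomorphism between the underlying functors of `M`-functors is an isomorphism of
`M`-functors. -/
def MFunctor.isoMk {C : Type u₁} [Category.{v₁} C] {M : MorphismProperty C}
    {D : Type u₂} [Category.{v₂} D] {N : MorphismProperty D}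
    {F G : MFunctor M N} (e : F.toFunctor ≅ G.toFunctor) : F ≅ G where
  hom := ⟨e.hom, fun _ _ _ _ => IsPullback.of_horiz_isIso ⟨by simp⟩⟩
  inv := ⟨e.inv, fun _ _ _ _ => IsPullback.of_horiz_isIso ⟨by simp⟩⟩
  hom_inv_id := MFunctor.Hom.ext e.hom_inv_id
  inv_hom_id := MFunctor.Hom.ext e.inv_hom_id

variable {C : Type w} [SmallCategory.{w} C] {M : MorphismProperty C}
  {D : Type u} [Category.{v} D] {N : MorphismProperty D} [StableMonics N]

/-- A transformation between cocontinuous `M`-functors on presheaves is cartesian as soon as its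
restriction along the Yoneda embedding is. -/
lemma isMCartesian_of_whiskerLeft_yoneda [PreservesColimitsOfSize.{w, w} (Par.incl N)]
    {F G : MFunctor (presheafMonics M) N} [PreservesColimitsOfSize.{w, w} F.toFunctor]
    (β : F.toFunctor ⟶ G.toFunctor) (hβ : IsMCartesian M (Functor.whiskerLeft yoneda β)) :
    IsMCartesian (presheafMonics M) β := by
  intro P Q μ hμ
  refine isPullback_of_isColimit
    (isColimitOfPreserves F.toFunctor (Presheaf.isColimitTautologicalCocone Q))
    (F.map_mem μ hμ) (G.map_mem μ hμ) (β.naturality μ).symm fun j => ?_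
  obtain ⟨A, m, p, hm, sq⟩ := hμ j.hom
  refine ⟨_, F.toFunctor.map p, F.toFunctor.map (yoneda.map m), F.map_isPullback hμ sq, ?_⟩
  -- By naturality of `β`, this pasting is the square required over the leg `j`.
  have := (hβ m hm).paste_horiz (G.map_isPullback hμ sq)
  refine IsPullback.of_iso this (Iso.refl _) (Iso.refl _) (Iso.refl _) (Iso.refl _) ?_ ?_ ?_ ?_
  · exact (Category.comp_id _).trans
      ((β.naturality p).symm.trans (Category.id_comp _).symm)
  · exact (Category.comp_id _).trans (Category.id_comp _).symm
  · simp
  · exact (Category.comp_id _).trans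
      ((β.naturality j.hom).symm.trans (Category.id_comp _).symm)

variable [StableMonics M]

/-- Restriction along the Yoneda embedding is an equivalence from cocontinuous `M`-functors on
presheaves to `M`-functors. -/
lemma isEquivalence_precompYoneda (hD : IsCocomplete.{w} N) :
    (precompYoneda.{w} M N).IsEquivalence := by
  have := hD.hasColimits
  have := hD.preservesColimits
  refine ⟨⟨fun {F G f g} h => ?_⟩, ⟨fun {F G} φ => ?_⟩, ⟨fun F => ?_⟩⟩
  · have : PreservesColimitsOfSize.{w, w} F.obj.toFunctor := F.property
    have := isLeftKanExtension_of_preservesColimits F.obj.toFunctor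
    apply ObjectProperty.hom_ext
    apply MFunctor.Hom.ext
    apply Functor.hom_ext_of_isLeftKanExtension _ (𝟙 (yoneda ⋙ F.obj.toFunctor))
    rw [Category.id_comp, Category.id_comp]
    exact congrArg MFunctor.Hom.nat h
  · have : PreservesColimitsOfSize.{w, w} F.obj.toFunctor := F.property
    have := isLeftKanExtension_of_preservesColimits F.obj.toFunctor
    let α : yoneda ⋙ F.obj.toFunctor ⟶ yoneda ⋙ G.obj.toFunctor := φ.nat
    obtain ⟨β, hβ⟩ : ∃ β : F.obj.toFunctor ⟶ G.obj.toFunctor, Functor.whiskerLeft yoneda β = α :=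
      ⟨_, (Category.id_comp _).symm.trans
        (Functor.descOfIsLeftKanExtension_fac _ (𝟙 (yoneda ⋙ F.obj.toFunctor)) _ α)⟩
    have hβ' : IsMCartesian (presheafMonics M) β :=
      isMCartesian_of_whiskerLeft_yoneda β (hβ ▸ φ.cartesian)
    exact ⟨ObjectProperty.homMk ⟨β, hβ'⟩, MFunctor.Hom.ext hβ⟩
  · let L := yoneda.leftKanExtension F.toFunctor
    let α : F.toFunctor ⟶ yoneda ⋙ L := yoneda.leftKanExtensionUnit F.toFunctor
    have hL : (Functor.LeftExtension.mk L α).IsPointwiseLeftKanExtension :=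
      Functor.isPointwiseLeftKanExtensionOfIsLeftKanExtension L α
    have hL' : PreservesColimitsOfSize.{w, w} L :=
      preservesColimits_of_isPointwiseLeftKanExtension hL
    -- The unit is invertible because Yoneda is fully faithful; transporting `F` along it makes the
    -- restriction of `L` an `M`-functor.
    have : IsIso α := hL.isIso_hom
    let F' := F.ofIso (asIso α)
    exact ⟨⟨MFunctor.ofPreservesColimits L F'.map_mem F'.map_isPullback, hL'⟩,
      ⟨MFunctor.isoMk (asIso α).symm⟩⟩

end Equivalence

end MCat

theorem theorem3 {C : Type w} [SmallCategory.{w} C]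
    (M : MorphismProperty C) [MCat.StableMonics M]
    {D : Type u} [Category.{v} D] (N : MorphismProperty D) [MCat.StableMonics N]
    (hD : MCat.IsCocomplete.{w} N) :
    MCat.IsCocomplete.{w} (MCat.presheafMonics M) ∧
      (MCat.precompYoneda.{w} M N).IsEquivalence :=
  ⟨MCat.isCocomplete_presheafMonics M, MCat.isEquivalence_precompYoneda hD⟩
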